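/- All graphs are finite with non-empty vertex set and may have parallel edges. For a graph $G$ and $S\subseteq V(G)$, let $\partial S$ be the set of edges of $G$ with precisely one end in $S$. An edge cut of $G$ is a set of edges of the form $\partial S$ with $S\subseteq V(G)$, and an $i$-cut is an edge cut with precisely $i$ edges. An $r$-regular graph $G$ is an $r$-graph if $|\partial S|\ge r$ for every $S\subseteq V(G)$ of odd cardinality. A 1-factor of $G$ is (the edge set of) a perfect matching of $G$. **Theorem.** Let $G$ be an $r$-graph with edge set $E$, and let $k$ be a positive integer. (a) If $r\ge 4$ is even, then $G$ has $k$ (not necessarily distinct) 1-factors $M_1,\dots,M_k$ such that $$\frac{\left|\bigcup_{i=1}^k M_i\right|}{|E|}\ \ge\ 1-\prod_{i=1}^k \frac{(r^2-3r+1)i-(r^2-5r+3)}{(r^2-2r-1)i-(r^2-4r-1)}$$ and $\sum_{i=1}^k |M_i\cap C|\le (r-1)k+2$ for each $(r+1)$-cut $C$. (b) If $r\ge 3$ is odd, then $G$ has $k$ (not necessarily distinct) 1-factors $M_1,\dots,M_k$ such that $$\frac{\left|\bigcup_{i=1}^k M_i\right|}{|E|}\ \ge\ 1-\prod_{i=1}^k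 \frac{(r^2-2r-1)i-(r^2-4r+1)}{(r^2-r-2)i-(r^2-3r-2)},$$ $\sum_{i=1}^k |M_i\cap C|=k$ for each $r$-cut $C$, and $\sum_{i=1}^k |M_i\cap D|\le rk+2$ for each $(r+2)$-cut $D$. -/

import Mathlib

namespace Graph

/-- The edge set `∂S`: all edges with precisely one end in `S`. -/
def edgeBoundary {α β : Type*} (G : Graph α β) (S : Set α) : Set β :=
  {e | ∃ x y, G.IsLink e x y ∧ x ∈ S ∧ y ∉ S}

/-- The degree of a vertex in a multigraph: the number of incident edges, loops counted twice. -/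
noncomputable def vertexDegree {α β : Type*} (G : Graph α β) (v : α) : ℕ :=
  (G.incidenceSet v).ncard + (G.loopSet v).ncard

/-- An `r`-graph: a finite `r`-regular multigraph (parallel edges allowed) such that `|∂S| ≥ r` for
every vertex set `S` of odd cardinality. (For `r > 0` the conditions exclude loops.) -/
structure IsRGraph {α β : Type*} (G : Graph α β) (r : ℕ) : Prop where
  finite_vertexSet : G.vertexSet.Finite
  finite_edgeSet : G.edgeSet.Finite
  regular : ∀ v ∈ G.vertexSet, G.vertexDegree v = r
  le_ncard_edgeBoundary : ∀ S ⊆ G.vertexSet, Odd S.ncard → r ≤ (G.edgeBoundary S).ncard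

/-- A 1-factor (perfect matching), as a set of edges: it contains no loop, and every vertex is
an end of precisely one of its edges. -/
structure IsOneFactor {α β : Type*} (G : Graph α β) (M : Set β) : Prop where
  subset_edgeSet : M ⊆ G.edgeSet
  not_isLoopAt : ∀ e ∈ M, ∀ v, ¬ G.IsLoopAt e v
  existsUnique_inc : ∀ v ∈ G.vertexSet, ∃! e, e ∈ M ∧ G.Inc e v

/-- An `i`-cut: an edge cut, that is, a set of the form `∂S`, consisting of precisely `i` edges. -/
def IsCutOfSize {α β : Type*} (G : Graph α β) (i : ℕ) (C : Set β) : Prop :=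
  (∃ S ⊆ G.vertexSet, C = G.edgeBoundary S) ∧ C.ncard = i

end Graph

/-! The matchings are chosen one at a time. After k of them put A = a * k + b, and let n(e) be the
number of those containing e. The invariant `IsSparseFamily` says that w = (A - n) / (r * A - k)
satisfies the odd-cut inequalities of Edmonds' polytope; star sums are 1 automatically, and n ≤ k <
A gives nonnegativity. An uncovered edge has weight A / (r * A - k), so Edmonds' theorem yields a
matching N in the minimal face of w containing at least that fraction of the uncovered edges. Each
step thus contributes a factor 1 - A / (r * A - k).

The invariant survives (`IsSparseFamily.exists_next`): N meets each tight odd cut once, and at any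
other odd cut parity makes the slack at least 2, which suffices when r ≤ 2 * a + 1 even if N
contains the whole cut. The choices a = r - 2, b = 2 (r even) and a = (r - 1) / 2, b = 1 (r odd)
give the two products, and for odd r the cut bounds are the invariant read at r-cuts and (r +
2)-cuts.

Edmonds' theorem (`hasTightMatchings`) goes by induction on the number of vertices. A tight matching
comes from Tutte's theorem if only stars are tight, and otherwise from gluing matchings of the two
contractions of a tight cut. A maximizer of the functional on the face then gives the optimal one.
-/

namespace EdgeCut

open Finset

open Classical in
/-- The edge cut of a vertex set `S` in the multigraph whose edge `e` has ends `f e` and `g e`. -/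
noncomputable def cut {V E : Type*} [Fintype E] (f g : E → V) (S : Finset V) : Finset E :=
  univ.filter fun e => ¬(f e ∈ S ↔ g e ∈ S)

/-- Fractional perfect matchings: the points of Edmonds' perfect matching polytope. -/
structure IsFractional {V E : Type*} [Fintype E] (f g : E → V) (w : E → ℝ) : Prop where
  nonneg : ∀ e, 0 ≤ w e
  loop : ∀ e, f e = g e → w e = 0
  vertex : ∀ v, ∑ e ∈ cut f g {v}, w e = 1
  odd : ∀ S : Finset V, Odd #S → 1 ≤ ∑ e ∈ cut f g S, w e

/-! ### Sums over edge cuts and uncrossing. -/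

section Basic

variable {V E : Type*} [Fintype E] {f g : E → V}

lemma mem_cut {S : Finset V} {e : E} : e ∈ cut f g S ↔ ¬(f e ∈ S ↔ g e ∈ S) := by
  classical
  simp [cut]

lemma cut_compl [Fintype V] [DecidableEq V] (S : Finset V) : cut f g Sᶜ = cut f g S := by
  ext e
  simp only [mem_cut, mem_compl]
  tauto

lemma cut_comp {V' : Type*} [Fintype V] [DecidableEq V'] (p : V → V') (T : Finset V') :
    cut (p ∘ f) (p ∘ g) T = cut f g (univ.filter fun v => p v ∈ T) := by
  ext e
  simp [mem_cut]

open Classical in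
lemma sum_cut (x : E → ℝ) (S : Finset V) :
    ∑ e ∈ cut f g S, x e = ∑ e, if f e ∈ S ↔ g e ∈ S then 0 else x e := by
  rw [cut, sum_filter]
  exact sum_congr rfl fun e _ => by split_ifs <;> simp_all

open Classical in
lemma sum_sum_cut {ι : Type*} (x : E → ℝ) (I : Finset ι) (S : ι → Finset V) :
    ∑ i ∈ I, ∑ e ∈ cut f g (S i), x e = ∑ e, #(I.filter fun i => e ∈ cut f g (S i)) * x e := by
  have h : ∀ i, ∑ e ∈ cut f g (S i), x e = ∑ e, if e ∈ cut f g (S i) then x e else 0 :=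
    fun i => by rw [sum_ite_mem, univ_inter]
  simp only [h]
  rw [sum_comm]
  refine sum_congr rfl fun e _ => ?_
  rw [← sum_filter, sum_const, nsmul_eq_mul]

-- Submodularity as an exact identity: the error term is the weight between `S \ T` and `T \ S`,
-- which must vanish when tight odd cuts are uncrossed.
open Classical in
lemma sum_cut_add_sum_cut (x : E → ℝ) (S T : Finset V) :
    ∑ e ∈ cut f g S, x e + ∑ e ∈ cut f g T, x e =
      ∑ e ∈ cut f g (S ∩ T), x e + ∑ e ∈ cut f g (S ∪ T), x e +
      2 * ∑ e, if (f e ∈ S \ T ∧ g e ∈ T \ S) ∨ (g e ∈ S \ T ∧ f e ∈ T \ S) then x e else 0 := by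
  simp only [sum_cut, mul_sum, ← sum_add_distrib]
  refine sum_congr rfl fun e _ => ?_
  simp only [mem_inter, mem_union, mem_sdiff]
  by_cases h1 : f e ∈ S <;> by_cases h2 : f e ∈ T <;> by_cases h3 : g e ∈ S <;>
    by_cases h4 : g e ∈ T <;> simp [h1, h2, h3, h4] <;> ring

open Classical in
lemma card_inter_cut (M : Finset E) (S : Finset V) :
    (#(M ∩ cut f g S) : ℝ) = ∑ e ∈ cut f g S, if e ∈ M then 1 else 0 := by
  rw [sum_ite_mem, inter_comm]
  simp

open Classical in
/-- Summing over the stars of the vertices of `S` counts the cut edges once, the inner edges twice. -/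
lemma sum_star_eq (x : E → ℕ) (hx : ∀ e, f e = g e → x e = 0) (S : Finset V) :
    ∑ v ∈ S, ∑ e ∈ cut f g {v}, x e =
      ∑ e ∈ cut f g S, x e + 2 * ∑ e, if f e ∈ S ∧ g e ∈ S then x e else 0 := by
  simp only [cut, sum_filter, mul_sum, ← sum_add_distrib]
  rw [sum_comm]
  refine sum_congr rfl fun e _ => ?_
  by_cases hl : f e = g e
  · simp [hx e hl]
  have key : ∀ v, (if ¬(f e ∈ ({v} : Finset V) ↔ g e ∈ ({v} : Finset V)) then x e else 0) =
      (if f e = v then x e else 0) + (if g e = v then x e else 0) := by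
    intro v
    by_cases h1 : f e = v <;> by_cases h2 : g e = v <;> simp_all
  simp only [key, sum_add_distrib, sum_ite_eq]
  by_cases h1 : f e ∈ S <;> by_cases h2 : g e ∈ S <;> simp [h1, h2] <;> ring

lemma IsFractional.le_one {w : E → ℝ} (hw : IsFractional f g w) (e : E) : w e ≤ 1 := by
  by_cases h : f e = g e
  · rw [hw.loop e h]; norm_num
  · rw [← hw.vertex (f e)]
    refine single_le_sum (f := w) (fun e _ => hw.nonneg e) ?_
    simpa [mem_cut] using fun h' => h h'.symm

end Basic

section Fractional

variable {V E : Type*} [Fintype V] [Fintype E] {f g : E → V} {w : E → ℝ}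

lemma IsFractional.even_card (hw : IsFractional f g w) : Even (Fintype.card V) := by
  by_contra h
  have := hw.odd univ (by simpa using h)
  have h0 : cut f g univ = ∅ := by ext; simp [mem_cut]
  rw [h0] at this
  norm_num at this

lemma IsFractional.odd_compl [DecidableEq V] (hw : IsFractional f g w) {S : Finset V}
    (hS : Odd #S) : Odd #Sᶜ := by
  have h := hw.even_card
  have h1 := card_compl_add_card S
  rw [← h1, Nat.even_add] at h
  rw [← Nat.not_even_iff_odd] at hS ⊢
  tauto

end Fractional

/-! ### Perfect matchings in the support, by Tutte's theorem. -/

section Tutte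

variable {V E : Type*} [Fintype V] [Fintype E] {f g : E → V} {w : E → ℝ}

/-- The simple graph spanned by the edges of positive weight. -/
def supportGraph (f g : E → V) (w : E → ℝ) : SimpleGraph V where
  Adj x y := x ≠ y ∧ ∃ e, 0 < w e ∧ (f e = x ∧ g e = y ∨ f e = y ∧ g e = x)
  symm := ⟨fun _ _ ⟨h, e, he, h'⟩ => ⟨h.symm, e, he, h'.symm⟩⟩
  loopless := ⟨fun _ h => h.1 rfl⟩

/-- Double counting of weight: each odd component left by deleting `u` receives weight at least 1,
all of it from `u`, while the stars of the vertices of `u` carry total weight |u|. -/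
lemma IsFractional.not_isTutteViolator (hw : IsFractional f g w) (u : Set V) :
    ¬(supportGraph f g w).IsTutteViolator u := by
  classical
  unfold SimpleGraph.IsTutteViolator
  set H := ((⊤ : (supportGraph f g w).Subgraph).deleteVerts u).coe with hH
  have hmem : ∀ v, v ∈ ((⊤ : (supportGraph f g w).Subgraph).deleteVerts u).verts ↔ v ∉ u := by simp
  let S : H.ConnectedComponent → Finset V := fun c => (c.supp.image Subtype.val).toFinset
  have hS : ∀ c v, v ∈ S c ↔ ∃ h, H.connectedComponentMk ⟨v, h⟩ = c := by
    intro c v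
    simp [S]
  have hSu : ∀ c v, v ∈ S c → v ∉ u := by
    intro c v h
    obtain ⟨h, -⟩ := (hS c v).1 h
    exact (hmem v).1 h
  have hodd : ∀ c ∈ H.oddComponents, Odd #(S c) := by
    intro c hc
    rw [← Set.ncard_eq_toFinset_card', Set.ncard_image_of_injective _ Subtype.val_injective]
    exact hc
  have hadj : ∀ e, 0 < w e → f e ∉ u → g e ∉ u → ∀ c, (f e ∈ S c ↔ g e ∈ S c) := by
    intro e he h1 h2 c
    rw [hS, hS]
    have hne : f e ≠ g e := fun h => he.ne' (hw.loop e h)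
    have : H.Adj ⟨f e, (hmem _).2 h1⟩ ⟨g e, (hmem _).2 h2⟩ := by
      have hG : (supportGraph f g w).Adj (f e) (g e) := ⟨hne, e, he, .inl ⟨rfl, rfl⟩⟩
      simpa [hH, h1, h2] using hG
    have := SimpleGraph.ConnectedComponent.connectedComponentMk_eq_of_adj this
    constructor
    · rintro ⟨h, rfl⟩; exact ⟨(hmem _).2 h2, this.symm⟩
    · rintro ⟨h, rfl⟩; exact ⟨(hmem _).2 h1, this⟩
  have hcase : ∀ e, 0 < w e → ∀ c, e ∈ cut f g (S c) →
      (f e ∈ u ∧ g e ∈ S c) ∨ (g e ∈ u ∧ f e ∈ S c) := by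
    intro e he c hc
    rw [mem_cut] at hc
    by_cases hf : f e ∈ S c
    · refine .inr ⟨?_, hf⟩
      by_contra hg
      exact hc (hadj e he (hSu c _ hf) hg c)
    · have hg : g e ∈ S c := by
        by_contra hg
        exact hc (iff_of_false hf hg)
      refine .inl ⟨?_, hg⟩
      by_contra hf
      exact hc (hadj e he hf (hSu c _ hg) c)
  have huniq : ∀ v c c', v ∈ S c → v ∈ S c' → c = c' := by
    intro v c c' h h'
    obtain ⟨_, rfl⟩ := (hS _ _).1 h
    obtain ⟨_, rfl⟩ := (hS _ _).1 h'
    rfl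
  have hcount : ∀ e, 0 < w e →
      #(H.oddComponents.toFinset.filter fun c => e ∈ cut f g (S c)) ≤
        #(u.toFinset.filter fun v => e ∈ cut f g {v}) := by
    intro e he
    have hne : f e ≠ g e := fun h => he.ne' (hw.loop e h)
    by_cases h0 : (H.oddComponents.toFinset.filter fun c => e ∈ cut f g (S c)) = ∅
    · rw [h0, card_empty]
      exact Nat.zero_le _
    refine le_trans (b := 1) ?_ ?_
    · rw [card_le_one]
      intro c hc c' hc'
      have h1 := hcase e he c (mem_filter.1 hc).2
      have h2 := hcase e he c' (mem_filter.1 hc').2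
      rcases h1 with ⟨h1, h3⟩ | ⟨h1, h3⟩ <;> rcases h2 with ⟨h2, h4⟩ | ⟨h2, h4⟩
      · exact huniq _ _ _ h3 h4
      · exact absurd h1 (hSu _ _ h4)
      · exact absurd h2 (hSu _ _ h3)
      · exact huniq _ _ _ h3 h4
    · obtain ⟨c, hc⟩ := nonempty_iff_ne_empty.2 h0
      rw [Nat.succ_le_iff, card_pos]
      rcases hcase e he c (mem_filter.1 hc).2 with ⟨h1, -⟩ | ⟨h1, -⟩
      · exact ⟨f e, by simpa [mem_cut, h1] using fun h => hne h.symm⟩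
      · exact ⟨g e, by simpa [mem_cut, h1] using hne⟩
  rw [not_lt, Set.ncard_eq_toFinset_card', Set.ncard_eq_toFinset_card', ← Nat.cast_le (α := ℝ)]
  calc (#H.oddComponents.toFinset : ℝ) = ∑ c ∈ H.oddComponents.toFinset, 1 := by simp
    _ ≤ ∑ c ∈ H.oddComponents.toFinset, ∑ e ∈ cut f g (S c), w e :=
        sum_le_sum fun c hc => hw.odd _ (hodd c (by simpa using hc))
    _ = ∑ e, #(H.oddComponents.toFinset.filter fun c => e ∈ cut f g (S c)) * w e := by
        rw [sum_sum_cut]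
    _ ≤ ∑ e, #(u.toFinset.filter fun v => e ∈ cut f g {v}) * w e := by
        refine sum_le_sum fun e _ => ?_
        rcases (hw.nonneg e).eq_or_lt with h | h
        · simp [← h]
        · exact mul_le_mul_of_nonneg_right (by exact_mod_cast hcount e h) h.le
    _ = ∑ v ∈ u.toFinset, ∑ e ∈ cut f g {v}, w e := by
        rw [sum_sum_cut]
    _ = #u.toFinset := by simp [hw.vertex]

lemma IsFractional.exists_perfect_of_support [DecidableEq E] (hw : IsFractional f g w) :
    ∃ M : Finset E, (∀ e ∈ M, 0 < w e) ∧ ∀ v, #(M ∩ cut f g {v}) = 1 := by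
  classical
  obtain ⟨N, hN⟩ := SimpleGraph.tutte.2 hw.not_isTutteViolator
  rw [SimpleGraph.Subgraph.isPerfectMatching_iff] at hN
  have hex : ∀ s : N.edgeSet, ∃ e, 0 < w e ∧ s(f e, g e) = s := by
    rintro ⟨s, hs⟩
    induction s with
    | _ x y =>
      obtain ⟨-, e, he, h'⟩ := N.adj_sub hs
      exact ⟨e, he, by rcases h' with ⟨rfl, rfl⟩ | ⟨rfl, rfl⟩ <;> simp [Sym2.eq_swap]⟩
  choose c hc hcs using hex
  refine ⟨univ.image c, ?_, ?_⟩
  · intro e he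
    simp only [mem_image, mem_univ, true_and] at he
    obtain ⟨s, rfl⟩ := he
    exact hc s
  intro v
  obtain ⟨y, hy, hy'⟩ := hN v
  rw [card_eq_one]
  have hmem : s(v, y) ∈ N.edgeSet := hy
  refine ⟨c ⟨s(v, y), hmem⟩, ?_⟩
  have hvy : v ≠ y := hy.ne
  ext e
  simp only [mem_inter, mem_image, mem_univ, true_and, mem_singleton, mem_cut]
  constructor
  · rintro ⟨⟨⟨s, hs⟩, rfl⟩, h2⟩
    have h3 := hcs ⟨s, hs⟩
    have : v ∈ s := by
      change s(_, _) = s at h3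
      rw [← h3, Sym2.mem_iff]
      by_contra h
      push Not at h
      exact h2 (by simp [h.1.symm, h.2.symm])
    obtain ⟨z, rfl⟩ := this
    obtain rfl := hy' z hs
    rfl
  · rintro rfl
    refine ⟨⟨_, rfl⟩, ?_⟩
    have := hcs ⟨_, hmem⟩
    rw [Sym2.eq_iff] at this
    rcases this with ⟨h1, h2⟩ | ⟨h1, h2⟩ <;> simp [h1, h2, hvy.symm]

end Tutte

/-! ### Tight matchings: contracting and gluing along a tight odd cut. -/

open Classical in
/-- `M` lies in the support of `w` and meets every tight odd cut of `w` in precisely one edge. -/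
structure IsTight {V E : Type*} [Fintype E] (f g : E → V) (w : E → ℝ) (M : Finset E) : Prop where
  pos : ∀ e ∈ M, 0 < w e
  card_inter_cut : ∀ S : Finset V, Odd #S → ∑ e ∈ cut f g S, w e = 1 → #(M ∩ cut f g S) = 1

universe u v

/-- Edmonds' theorem for the multigraphs with vertex type `V`: every linear functional is at least
as large at some tight perfect matching as at the given fractional perfect matching. -/
def HasTightMatchings (V : Type u) (E : Type v) [Fintype E] : Prop :=
  ∀ (f g : E → V) (w : E → ℝ), IsFractional f g w → ∀ c : E → ℝ,
    ∃ M, IsTight f g w M ∧ ∑ e, c e * w e ≤ ∑ e ∈ M, c e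

/-- Makes odd cuts of a contraction correspond to odd cuts of the original multigraph. -/
lemma odd_card_preimage {V V' : Type*} [Fintype V] [DecidableEq V'] (p : V → V')
    (hp : ∀ x, Odd #(univ.filter fun v => p v = x)) (T : Finset V') :
    Odd #(univ.filter fun v => p v ∈ T) ↔ Odd #T := by
  have h : #(univ.filter fun v => p v ∈ T) = ∑ x ∈ T, #(univ.filter fun v => p v = x) := by
    rw [card_eq_sum_card_fiberwise (f := p) (t := T) (fun v hv => by simpa using hv)]
    refine sum_congr rfl fun x hx => congrArg card ?_
    ext v
    simp only [mem_filter, mem_univ, true_and, and_iff_right_iff_imp]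
    rintro rfl
    exact hx
  rw [h, odd_sum_iff_odd_card_odd, filter_true_of_mem fun x _ => hp x]

section

variable {V : Type u} {E : Type v} [Fintype V] [Fintype E] {f g : E → V} {w : E → ℝ}

-- Contract `S` to the vertex `none`, keeping the edge type: edges inside `S` become loops and get
-- weight 0. Tightness of `S` is the star condition at `none`.
open Classical in
lemma IsFractional.exists_of_contract (hw : IsFractional f g w)
    (ih : ∀ (V' : Type u) [Fintype V'], Fintype.card V' < Fintype.card V → HasTightMatchings V' E)
    {S : Finset V} (hS : Odd #S) (hS1 : 1 < #S) (ht : ∑ e ∈ cut f g S, w e = 1)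
    {e₀ : E} (he₀ : e₀ ∈ cut f g S) (hwe₀ : 0 < w e₀) :
    ∃ M : Finset E, e₀ ∈ M ∧ (∀ e ∈ M, 0 < w e) ∧ (∀ e ∈ M, ¬(f e ∈ S ∧ g e ∈ S)) ∧
      ∀ T : Finset V, Odd #T → (S ⊆ T ∨ Disjoint S T) → ∑ e ∈ cut f g T, w e = 1 →
        #(M ∩ cut f g T) = 1 := by
  let p : V → Option {v // v ∉ S} := fun v => if h : v ∈ S then none else some ⟨v, h⟩
  have hpnone : ∀ v, p v = none ↔ v ∈ S := fun v => by simp [p]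
  have hpsome : ∀ v x, p v = some x ↔ v = x.1 := by
    rintro v ⟨x, hx⟩
    by_cases h : v ∈ S
    · simp only [p, h, dite_true, reduceCtorEq, false_iff]
      rintro rfl
      exact hx h
    · simp [p, h]
  have hpeq : ∀ x y, p x = p y → x = y ∨ (x ∈ S ∧ y ∈ S) := by
    intro x y h
    cases hy : p y with
    | none => exact .inr ⟨(hpnone x).1 (h.trans hy), (hpnone y).1 hy⟩
    | some z => exact .inl (((hpsome x z).1 (h.trans hy)).trans ((hpsome y z).1 hy).symm)
  have hfnone : (univ.filter fun v => p v = none) = S := by ext; simp [hpnone]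
  have hfsome : ∀ x, (univ.filter fun v => p v = some x) = {x.1} := by
    intro x; ext; simp [hpsome]
  have hfib : ∀ x, Odd #(univ.filter fun v => p v = x) := by
    rintro (_ | x)
    · rwa [hfnone]
    · simp [hfsome]
  let w' : E → ℝ := fun e => if p (f e) = p (g e) then 0 else w e
  have hsum : ∀ T : Finset (Option {v // v ∉ S}), ∑ e ∈ cut (p ∘ f) (p ∘ g) T, w' e =
      ∑ e ∈ cut f g (univ.filter fun v => p v ∈ T), w e := by
    intro T
    rw [cut_comp]
    refine sum_congr rfl fun e he => if_neg fun h => ?_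
    simp [mem_cut, h] at he
  have hw' : IsFractional (p ∘ f) (p ∘ g) w' := by
    refine ⟨fun e => ?_, fun e he => if_pos he, fun x => ?_, fun T hT => ?_⟩
    · by_cases h : p (f e) = p (g e)
      · simp [w', h]
      · simpa [w', h] using hw.nonneg e
    · rw [hsum]
      cases x with
      | none => simpa [hfnone] using ht
      | some x => simpa [hfsome] using hw.vertex x.1
    · rw [hsum]
      exact hw.odd _ ((odd_card_preimage p hfib T).2 hT)
  have hcard : Fintype.card (Option {v // v ∉ S}) < Fintype.card V := by
    have h1 : #S ≤ Fintype.card V := card_le_univ S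
    rw [Fintype.card_option, Fintype.card_subtype_compl]
    simp only [Fintype.card_coe]
    omega
  -- This functional has the positive value `w e₀` at the weights, which forces `e₀` into the
  -- matching.
  obtain ⟨M, hM, hc⟩ := ih _ hcard _ _ _ hw' fun e => if e = e₀ then 1 else 0
  have hMw : ∀ e ∈ M, p (f e) ≠ p (g e) := by
    intro e he h
    have := hM.pos e he
    simp [w', h] at this
  refine ⟨M, ?_, fun e he => ?_, fun e he h => ?_, fun T hT hST hT1 => ?_⟩
  · by_contra h
    have h1 : p (f e₀) ≠ p (g e₀) := by
      intro h
      rw [mem_cut] at he₀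
      rcases hpeq _ _ h with h | h
      · exact he₀ (by rw [h])
      · exact he₀ (iff_of_true h.1 h.2)
    have h2 : w' e₀ = w e₀ := if_neg h1
    simp [h, h2] at hc
    exact hc.not_gt hwe₀
  · have := hM.pos e he
    simpa [w', hMw e he] using this
  · exact hMw e he (((hpnone _).2 h.1).trans ((hpnone _).2 h.2).symm)
  · have hpre : (univ.filter fun v => p v ∈ T.image p) = T := by
      ext v
      simp only [mem_filter, mem_univ, true_and, mem_image]
      refine ⟨?_, fun h => ⟨v, h, rfl⟩⟩
      rintro ⟨t, htT, h⟩
      rcases hpeq _ _ h with rfl | ⟨h1, h2⟩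
      · exact htT
      · rcases hST with h | h
        · exact h h2
        · exact absurd htT (disjoint_left.1 h h1)
    have h := hM.card_inter_cut (T.image p) ((odd_card_preimage p hfib _).1 (by rwa [hpre]))
    rw [hsum, cut_comp, hpre] at h
    exact h hT1

-- Contracting `S` and `Sᶜ` gives two matchings that share `e₀`, their only edge across `S`, so
-- their union is the candidate. Tight cuts nested with `S` see only one of the two; the others are
-- uncrossed with `S`.
open Classical in
lemma IsFractional.exists_isTight_of_tight_cut (hw : IsFractional f g w)
    (ih : ∀ (V' : Type u) [Fintype V'], Fintype.card V' < Fintype.card V → HasTightMatchings V' E)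
    {S : Finset V} (hS : Odd #S) (hS1 : 1 < #S) (hS2 : 1 < #Sᶜ)
    (ht : ∑ e ∈ cut f g S, w e = 1) : ∃ M, IsTight f g w M := by
  obtain ⟨e₀, he₀, hwe₀⟩ : ∃ e₀ ∈ cut f g S, 0 < w e₀ := by
    refine exists_lt_of_sum_lt (f := fun _ => (0 : ℝ)) ?_
    simp [ht]
  obtain ⟨M₁, h1e, h1w, h1S, h1⟩ := hw.exists_of_contract ih hS hS1 ht he₀ hwe₀
  obtain ⟨M₂, h2e, h2w, h2S, h2⟩ := hw.exists_of_contract ih (hw.odd_compl hS) hS2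
    (by rwa [cut_compl]) (e₀ := e₀) (by rwa [cut_compl]) hwe₀
  have heq : ∀ (A : Finset V) (M : Finset E), #(M ∩ cut f g S) = 1 → e₀ ∈ M →
      ∀ e ∈ M, e ∈ cut f g S → e = e₀ := by
    intro A M h h' e he hc
    obtain ⟨x, hx⟩ := card_eq_one.1 h
    have ha : e ∈ M ∩ cut f g S := mem_inter.2 ⟨he, hc⟩
    have hb : e₀ ∈ M ∩ cut f g S := mem_inter.2 ⟨h', he₀⟩
    rw [hx, mem_singleton] at ha hb
    rw [ha, hb]
  have h1C := heq S M₁ (h1 S hS (.inl subset_rfl) ht) h1e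
  have h2C := heq S M₂ (h2 S hS (.inr disjoint_compl_left) ht) h2e
  have hw0 : ∀ e ∈ M₁ ∪ M₂, 0 < w e := by
    intro e he
    rcases mem_union.1 he with he | he
    · exact h1w e he
    · exact h2w e he
  have hsup : ∀ T, Odd #T → S ⊆ T → ∑ e ∈ cut f g T, w e = 1 → #((M₁ ∪ M₂) ∩ cut f g T) = 1 := by
    intro T hT hST hT1
    rw [← h1 T hT (.inl hST) hT1]
    congr 1
    ext e
    simp only [mem_inter, mem_union]
    refine ⟨fun ⟨h, he⟩ => ⟨h.elim id fun h => ?_, he⟩, fun ⟨h, he⟩ => ⟨.inl h, he⟩⟩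
    have hc : e ∈ cut f g S := by
      have := h2S e h
      have hf := @hST (f e)
      have hg := @hST (g e)
      simp only [mem_compl] at this
      rw [mem_cut] at he ⊢
      tauto
    rwa [h2C e h hc]
  have hsub : ∀ T, Odd #T → T ⊆ S → ∑ e ∈ cut f g T, w e = 1 → #((M₁ ∪ M₂) ∩ cut f g T) = 1 := by
    intro T hT hST hT1
    rw [← h2 T hT (.inr (disjoint_left.2 fun x hx hx' => mem_compl.1 hx (hST hx'))) hT1]
    congr 1
    ext e
    simp only [mem_inter, mem_union]
    refine ⟨fun ⟨h, he⟩ => ⟨h.elim (fun h => ?_) id, he⟩, fun ⟨h, he⟩ => ⟨.inr h, he⟩⟩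
    have hc : e ∈ cut f g S := by
      have := h1S e h
      have hf := @hST (f e)
      have hg := @hST (g e)
      rw [mem_cut] at he ⊢
      tauto
    rwa [h1C e h hc]
  -- Uncrossing: `S ∩ T` and `S ∪ T` are odd, hence both tight, and no edge of positive weight joins
  -- `S \ T` to `T \ S`. The same identity for the indicator of the union then determines its count
  -- on `T`.
  have hinter : ∀ T, Odd #T → Odd #(S ∩ T) → ∑ e ∈ cut f g T, w e = 1 →
      #((M₁ ∪ M₂) ∩ cut f g T) = 1 := by
    intro T hT hST hT1
    have hST' : Odd #(S ∪ T) := by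
      have := card_union_add_card_inter S T
      obtain ⟨a, ha⟩ := hT
      obtain ⟨b, hb⟩ := hS
      obtain ⟨c, hc⟩ := hST
      exact ⟨a + b - c, by omega⟩
    have key := sum_cut_add_sum_cut (f := f) (g := g) w S T
    have hA := hw.odd _ hST
    have hB := hw.odd _ hST'
    have hnn : ∀ e ∈ univ, 0 ≤ if (f e ∈ S \ T ∧ g e ∈ T \ S) ∨ (g e ∈ S \ T ∧ f e ∈ T \ S)
        then w e else 0 := by
      intro e _
      split_ifs
      exacts [hw.nonneg e, le_rfl]
    have hN := sum_nonneg hnn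
    have h0 := (sum_eq_zero_iff_of_nonneg hnn).1 (by linarith)
    have key' := sum_cut_add_sum_cut (f := f) (g := g) (fun e => if e ∈ M₁ ∪ M₂ then (1 : ℝ) else 0) S T
    simp only [← card_inter_cut] at key'
    rw [hsub _ hST inter_subset_left (by linarith), hsup _ hST' subset_union_left (by linarith),
      hsup S hS subset_rfl ht, sum_eq_zero] at key'
    · have : (#((M₁ ∪ M₂) ∩ cut f g T) : ℝ) = 1 := by push_cast at key'; linarith
      exact_mod_cast this
    · intro e _
      split_ifs with h h'
      · have := h0 e (mem_univ e)
        rw [if_pos h] at this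
        exact absurd this (hw0 e h').ne'
      · rfl
      · rfl
  refine ⟨M₁ ∪ M₂, hw0, fun T hT hT1 => ?_⟩
  by_cases hST : Odd #(S ∩ T)
  · exact hinter T hT hST hT1
  -- If `S ∩ T` is even, then `S \ T` is odd and `Tᶜ` can be used instead.
  · rw [← cut_compl]
    refine hinter Tᶜ (hw.odd_compl hT) ?_ (by rwa [cut_compl])
    have := card_inter_add_card_sdiff S T
    rw [← sdiff_eq_inter_compl]
    rw [← this, Nat.odd_add] at hS
    rw [Nat.not_odd_iff_even] at hST
    by_contra h
    rw [Nat.not_odd_iff_even] at h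
    have := hS.2 h
    exact (Nat.not_even_iff_odd.2 this) hST

-- If no tight odd cut has two or more vertices on both sides, every tight odd cut is a star, and
-- any perfect matching of the support is tight.
open Classical in
lemma IsFractional.exists_isTight (hw : IsFractional f g w)
    (ih : ∀ (V' : Type u) [Fintype V'], Fintype.card V' < Fintype.card V → HasTightMatchings V' E) :
    ∃ M, IsTight f g w M := by
  by_cases h : ∃ S : Finset V, Odd #S ∧ 1 < #S ∧ 1 < #Sᶜ ∧ ∑ e ∈ cut f g S, w e = 1
  · obtain ⟨S, hS, hS1, hS2, ht⟩ := h
    exact hw.exists_isTight_of_tight_cut ih hS hS1 hS2 ht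
  · push Not at h
    obtain ⟨M, hMw, hM⟩ := hw.exists_perfect_of_support
    refine ⟨M, hMw, fun S hS ht => ?_⟩
    have hone : ∀ T : Finset V, Odd #T → ¬ 1 < #T → #(M ∩ cut f g T) = 1 := by
      intro T hT hT1
      obtain ⟨v, rfl⟩ := card_eq_one.1 (le_antisymm (not_lt.1 hT1) hT.pos)
      exact hM v
    by_cases hS1 : 1 < #S
    · by_cases hS2 : 1 < #Sᶜ
      · exact absurd ht (h S hS hS1 hS2)
      · rw [← cut_compl]
        exact hone _ (hw.odd_compl hS) hS2
    · exact hone S hS hS1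

end

/-! ### Optimizing a linear functional on a face. -/

section

variable {V : Type u} {E : Type v} [Fintype V] [Fintype E] {f g : E → V} {w : E → ℝ}

/-- The smallest face of the perfect matching polytope containing `w`. -/
def face (f g : E → V) (w : E → ℝ) : Set (E → ℝ) :=
  {x | IsFractional f g x ∧ (∀ e, w e = 0 → x e = 0) ∧
    ∀ S : Finset V, Odd #S → ∑ e ∈ cut f g S, w e = 1 → ∑ e ∈ cut f g S, x e = 1}

omit [Fintype V] in
lemma isCompact_face (w : E → ℝ) : IsCompact (face f g w) := by
  refine (isCompact_Icc (a := (0 : E → ℝ)) (b := 1)).of_isClosed_subset ?_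
    fun x hx => ⟨hx.1.nonneg, hx.1.le_one⟩
  have h : face f g w = {x | (∀ e, 0 ≤ x e) ∧ (∀ e, f e = g e → x e = 0) ∧
      (∀ v, ∑ e ∈ cut f g {v}, x e = 1) ∧
      (∀ S : Finset V, Odd #S → 1 ≤ ∑ e ∈ cut f g S, x e) ∧ (∀ e, w e = 0 → x e = 0) ∧
      ∀ S : Finset V, Odd #S → ∑ e ∈ cut f g S, w e = 1 → ∑ e ∈ cut f g S, x e = 1} := by
    ext x
    exact ⟨fun ⟨⟨h1, h2, h3, h4⟩, h5, h6⟩ => ⟨h1, h2, h3, h4, h5, h6⟩,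
      fun ⟨h1, h2, h3, h4, h5, h6⟩ => ⟨⟨h1, h2, h3, h4⟩, h5, h6⟩⟩
  have hc : ∀ S : Finset V, Continuous fun x : E → ℝ => ∑ e ∈ cut f g S, x e := by fun_prop
  rw [h]
  simp only [Set.ofPred_and, Set.ofPred_forall]
  refine .inter (isClosed_iInter fun e => isClosed_le continuous_const (continuous_apply e)) <|
    .inter (isClosed_iInter fun e => isClosed_iInter fun _ =>
      isClosed_eq (continuous_apply e) continuous_const) <|
    .inter (isClosed_iInter fun v => isClosed_eq (hc _) continuous_const) <|
    .inter (isClosed_iInter fun S => isClosed_iInter fun _ => isClosed_le continuous_const (hc S)) <|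
    .inter (isClosed_iInter fun e => isClosed_iInter fun _ =>
      isClosed_eq (continuous_apply e) continuous_const) <|
    isClosed_iInter fun S => isClosed_iInter fun _ => isClosed_iInter fun _ =>
      isClosed_eq (hc S) continuous_const

omit [Fintype V] in
lemma IsFractional.mem_face (hw : IsFractional f g w) : w ∈ face f g w :=
  ⟨hw, fun _ h => h, fun _ _ h => h⟩

open Classical Filter Topology in
/-- Moving a fractional perfect matching slightly away from a tight perfect matching stays in the
face of the polytope. -/
lemma IsTight.eventually_mem_face (hw : IsFractional f g w) {M : Finset E} (hM : IsTight f g w M) :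
    ∀ᶠ t : ℝ in 𝓝[>] 0, (fun e => w e + t * (w e - if e ∈ M then 1 else 0)) ∈ face f g w := by
  have hsum : ∀ (t : ℝ) (S : Finset V),
      ∑ e ∈ cut f g S, (w e + t * (w e - if e ∈ M then 1 else 0)) =
        ∑ e ∈ cut f g S, w e + t * (∑ e ∈ cut f g S, w e - #(M ∩ cut f g S)) := by
    intro t S
    rw [EdgeCut.card_inter_cut, sum_add_distrib, ← mul_sum, sum_sub_distrib]
  have hcont : ∀ a b c : ℝ, c < a → ∀ᶠ t : ℝ in 𝓝[>] 0, c ≤ a + t * b := by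
    intro a b c h
    have : Tendsto (fun t : ℝ => a + t * b) (𝓝 0) (𝓝 (a + 0 * b)) :=
      Continuous.tendsto (by fun_prop) 0
    rw [zero_mul, add_zero] at this
    exact ((this.eventually (lt_mem_nhds h)).mono fun _ h => h.le).filter_mono nhdsWithin_le_nhds
  have htight : ∀ (t : ℝ) (S : Finset V), Odd #S → ∑ e ∈ cut f g S, w e = 1 →
      ∑ e ∈ cut f g S, (w e + t * (w e - if e ∈ M then 1 else 0)) = 1 := by
    intro t S hS h
    rw [hsum, h, hM.card_inter_cut S hS h]
    simp
  have hzero : ∀ (t : ℝ) e, w e = 0 → w e + t * (w e - if e ∈ M then 1 else 0) = 0 := by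
    intro t e h
    rw [if_neg fun he => (hM.pos e he).ne' h, h]
    simp
  have h1 : ∀ᶠ t : ℝ in 𝓝[>] 0, ∀ e, 0 ≤ w e + t * (w e - if e ∈ M then 1 else 0) := by
    rw [eventually_all]
    intro e
    rcases (hw.nonneg e).eq_or_lt with h | h
    · exact .of_forall fun t => (hzero t e h.symm).ge
    · exact hcont _ _ _ h
  have h2 : ∀ᶠ t : ℝ in 𝓝[>] 0, ∀ S : Finset V, Odd #S →
      1 ≤ ∑ e ∈ cut f g S, (w e + t * (w e - if e ∈ M then 1 else 0)) := by
    rw [eventually_all]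
    intro S
    by_cases hS : Odd #S
    · rcases (hw.odd S hS).eq_or_lt with h | h
      · exact .of_forall fun t _ => (htight t S hS h.symm).ge
      · simp only [hsum]
        exact (hcont _ _ _ h).mono fun _ h _ => h
    · exact .of_forall fun t h => absurd h hS
  filter_upwards [h1, h2] with t h1 h2
  exact ⟨⟨h1, fun e he => hzero t e (hw.loop e he),
    fun v => htight t _ (by simp) (hw.vertex v), h2⟩, hzero t, htight t⟩

-- Let x maximize the functional on the face of `w`, and let `M` be tight for x, hence also for `w`.
-- Were `M` worse than x, a small move from x directly away from `M` would stay in the face and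
-- increase the functional.
open Filter Topology in
lemma IsFractional.exists_isTight_le (hw : IsFractional f g w)
    (ih : ∀ (V' : Type u) [Fintype V'], Fintype.card V' < Fintype.card V → HasTightMatchings V' E)
    (c : E → ℝ) : ∃ M, IsTight f g w M ∧ ∑ e, c e * w e ≤ ∑ e ∈ M, c e := by
  classical
  obtain ⟨x, hx, hmax⟩ := (isCompact_face w).exists_isMaxOn ⟨w, hw.mem_face⟩
    (f := fun x : E → ℝ => ∑ e, c e * x e) (by fun_prop)
  rw [isMaxOn_iff] at hmax
  obtain ⟨M, hM⟩ := hx.1.exists_isTight ih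
  refine ⟨M, ⟨fun e he => ?_, fun S hS h => hM.card_inter_cut S hS (hx.2.2 S hS h)⟩,
    (hmax w hw.mem_face).trans ?_⟩
  · exact (hw.nonneg e).lt_of_ne fun h => (hM.pos e he).ne' (hx.2.1 e h.symm)
  · by_contra! hlt
    obtain ⟨t, ht, ht0⟩ := ((hM.eventually_mem_face hx.1).and self_mem_nhdsWithin).exists
    have hle := hmax _ ⟨ht.1, fun e h => ht.2.1 e (hx.2.1 e h),
      fun S hS h => ht.2.2 S hS (hx.2.2 S hS h)⟩
    have hsum : ∑ e, c e * (x e + t * (x e - if e ∈ M then 1 else 0)) =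
        ∑ e, c e * x e + t * (∑ e, c e * x e - ∑ e ∈ M, c e) := by
      have hM' : ∑ e ∈ M, c e = ∑ e, if e ∈ M then c e else 0 := by rw [sum_ite_mem, univ_inter]
      rw [hM', ← sum_sub_distrib, mul_sum, ← sum_add_distrib]
      refine sum_congr rfl fun e _ => ?_
      split_ifs <;> ring
    rw [hsum] at hle
    have : 0 < t * (∑ e, c e * x e - ∑ e ∈ M, c e) := mul_pos ht0 (by linarith)
    linarith

end

theorem hasTightMatchings (V : Type u) (E : Type v) [Fintype V] [Fintype E] :
    HasTightMatchings V E := by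
  suffices h : ∀ (n : ℕ) (V : Type u) [Fintype V], Fintype.card V = n → HasTightMatchings V E from
    h _ V rfl
  intro n
  induction n using Nat.strong_induction_on with
  | _ n ih =>
    intro V _ hV f g w hw c
    exact hw.exists_isTight_le (fun V' _ h => ih _ (hV ▸ h) V' rfl) c

/-! ### Sparse families of perfect matchings and the greedy step. -/

section Family

variable {V E : Type*} [Fintype E] {f g : E → V} {r a b k : ℕ}

/-- The multigraph with end maps `f` and `g` is an `r`-graph. -/
structure IsRGraph (f g : E → V) (r : ℕ) : Prop where
  ne : ∀ e, f e ≠ g e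
  card_star : ∀ v, #(cut f g {v}) = r
  le_card_cut : ∀ S : Finset V, Odd #S → r ≤ #(cut f g S)

open Classical in
/-- `M` is the edge set of a perfect matching (of a loopless multigraph). -/
def IsPerfect (f g : E → V) (M : Finset E) : Prop :=
  ∀ v, #(M ∩ cut f g {v}) = 1

open Classical in
/-- The first `k` members of `M` are perfect matchings, and they cover the odd cuts so sparsely
that `e ↦ a * k + b - #{i < k | e ∈ M i}` is a multiple of a fractional perfect matching. -/
structure IsSparseFamily (f g : E → V) (r a b k : ℕ) (M : ℕ → Finset E) : Prop where
  perfect : ∀ i < k, IsPerfect f g (M i)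
  sum_le : ∀ S : Finset V, Odd #S →
    ∑ i ∈ range k, #(M i ∩ cut f g S) + r * (a * k + b) ≤ #(cut f g S) * (a * k + b) + k

lemma IsRGraph.even_card_cut_iff (h : IsRGraph f g r) (S : Finset V) :
    Even #(cut f g S) ↔ Even (r * #S) := by
  have := sum_star_eq (f := f) (g := g) (fun _ => 1) (fun e he => absurd he (h.ne e)) S
  simp only [sum_const, h.card_star, smul_eq_mul, mul_one] at this
  rw [mul_comm r, this, Nat.even_add]
  simp

open Classical in
lemma IsPerfect.existsUnique {M : Finset E} (hM : IsPerfect f g M) (v : V) :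
    ∃! e, e ∈ M ∧ e ∈ cut f g {v} := by
  obtain ⟨e, he⟩ := card_eq_one.1 (hM v)
  refine ⟨e, mem_inter.1 (he ▸ mem_singleton_self e), fun e' h => ?_⟩
  exact mem_singleton.1 (he ▸ mem_inter.2 h)

open Classical in
lemma IsPerfect.even_card_inter_cut_iff {M : Finset E} (hM : IsPerfect f g M)
    (h : ∀ e, f e ≠ g e) (S : Finset V) : Even #(M ∩ cut f g S) ↔ Even #S := by
  have := sum_star_eq (f := f) (g := g) (fun e => if e ∈ M then 1 else 0)
    (fun e he => absurd he (h e)) S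
  have hc : ∀ T : Finset V, ∑ e ∈ cut f g T, (if e ∈ M then 1 else 0) = #(M ∩ cut f g T) := by
    intro T
    rw [sum_ite_mem, inter_comm]
    simp
  simp only [hc, hM _, sum_const, smul_eq_mul, mul_one] at this
  rw [this, Nat.even_add]
  simp

open Classical in
lemma IsSparseFamily.odd_card_inter {M : ℕ → Finset E} (hM : IsSparseFamily f g r a b k M)
    (h : IsRGraph f g r) {S : Finset V} (hS : Odd #S) {i : ℕ} (hi : i < k) :
    Odd #(M i ∩ cut f g S) := by
  rw [← Nat.not_even_iff_odd, (hM.perfect i hi).even_card_inter_cut_iff h.ne]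
  exact Nat.not_even_iff_odd.2 hS

open Classical in
lemma IsSparseFamily.exists_eq_add {M : ℕ → Finset E} (hM : IsSparseFamily f g r a b k M)
    (h : IsRGraph f g r) {S : Finset V} (hS : Odd #S) :
    ∃ m, ∑ i ∈ range k, #(M i ∩ cut f g S) = k + 2 * m := by
  have : ∀ i ∈ range k, ∃ m, #(M i ∩ cut f g S) = 1 + 2 * m := by
    intro i hi
    obtain ⟨m, hm⟩ := hM.odd_card_inter h hS (mem_range.1 hi)
    exact ⟨m, by omega⟩
  choose! m hm using this
  exact ⟨∑ i ∈ range k, m i, by rw [sum_congr rfl hm]; simp [sum_add_distrib, mul_sum]⟩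

lemma IsRGraph.exists_card_cut_eq (h : IsRGraph f g r) {S : Finset V} (hS : Odd #S) :
    ∃ t, #(cut f g S) = r + 2 * t := by
  have h1 := h.even_card_cut_iff S
  have h2 := h.le_card_cut S hS
  rw [Nat.even_mul, or_iff_left (Nat.not_even_iff_odd.2 hS), Nat.even_iff, Nat.even_iff] at h1
  exact ⟨(#(cut f g S) - r) / 2, by omega⟩

open Classical in
/-- The edges in none of the first `k` members of `M`. -/
noncomputable def uncovered (M : ℕ → Finset E) (k : ℕ) : Finset E :=
  univ.filter fun e => ∀ i < k, e ∉ M i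

open Classical in
lemma IsSparseFamily.exists_next [Fintype V] {M : ℕ → Finset E} (hM : IsSparseFamily f g r a b k M)
    (h : IsRGraph f g r) (hr : 2 ≤ r) (ha : 1 ≤ a) (hra : r ≤ 2 * a + 1) (hb : 1 ≤ b) :
    ∃ N : Finset E, IsPerfect f g N ∧
      (∀ S : Finset V, Odd #S →
        ∑ i ∈ range k, #(M i ∩ cut f g S) + #(N ∩ cut f g S) + r * (a * (k + 1) + b) ≤
          #(cut f g S) * (a * (k + 1) + b) + (k + 1)) ∧
      (#(uncovered M k \ N) : ℝ) ≤
        #(uncovered M k) * (((r - 1) * (a * k + b) - k) / (r * (a * k + b) - k)) := by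
  set A : ℕ := a * k + b with hA
  have hkA : k + 1 ≤ A := by nlinarith
  have hkA' : (k : ℝ) + 1 ≤ A := by exact_mod_cast hkA
  have hr' : (2 : ℝ) ≤ r := by exact_mod_cast hr
  set D : ℝ := r * A - k with hD
  have hD0 : 0 < D := by nlinarith
  let n : E → ℝ := fun e => ∑ i ∈ range k, if e ∈ M i then 1 else 0
  let w : E → ℝ := fun e => (A - n e) / D
  have hsum : ∀ S, ∑ e ∈ cut f g S, w e =
      (#(cut f g S) * A - (∑ i ∈ range k, #(M i ∩ cut f g S) : ℕ)) / D := by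
    intro S
    rw [← sum_div, sum_sub_distrib, sum_comm, Nat.cast_sum]
    simp only [EdgeCut.card_inter_cut]
    simp
  have hw1 : ∀ S, (∑ i ∈ range k, #(M i ∩ cut f g S)) + r * A = #(cut f g S) * A + k →
      ∑ e ∈ cut f g S, w e = 1 := by
    intro S hS
    rw [hsum, div_eq_one_iff_eq hD0.ne', hD]
    have : ((∑ i ∈ range k, #(M i ∩ cut f g S) : ℕ) : ℝ) + r * A = #(cut f g S) * A + k := by
      exact_mod_cast hS
    linarith
  have hstar : ∀ v, ∑ e ∈ cut f g {v}, w e = 1 := by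
    intro v
    refine hw1 _ ?_
    rw [h.card_star, sum_congr rfl fun i hi => hM.perfect i (mem_range.1 hi) v]
    simp [add_comm]
  have hw : IsFractional f g w := by
    refine ⟨fun e => div_nonneg ?_ hD0.le, fun e he => absurd he (h.ne e), hstar, fun S hS => ?_⟩
    · have : n e ≤ ∑ i ∈ range k, 1 := sum_le_sum fun i _ => by split_ifs <;> norm_num
      simp only [sum_const, card_range, nsmul_eq_mul, mul_one] at this
      linarith
    · rw [hsum, le_div_iff₀ hD0]
      have : ((∑ i ∈ range k, #(M i ∩ cut f g S) : ℕ) : ℝ) + r * A ≤ #(cut f g S) * A + k := by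
        exact_mod_cast hM.sum_le S hS
      linarith
  obtain ⟨N, hN, hc⟩ := hasTightMatchings V E f g w hw fun e => if e ∈ uncovered M k then 1 else 0
  refine ⟨N, fun v => hN.card_inter_cut _ (by simp) (hstar v), fun S hS => ?_, ?_⟩
  · obtain ⟨t, ht⟩ := h.exists_card_cut_eq hS
    obtain ⟨m, hm⟩ := hM.exists_eq_add h hS
    have hle := hM.sum_le S hS
    have hA' : a * (k + 1) + b = A + a := by rw [hA]; ring
    rw [← hA] at hle
    rw [hA']
    rcases hle.eq_or_lt with heq | hlt
    -- Tight cut: `N` adds just 1, and the other increments compare by r ≤ |∂S|.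
    · rw [hN.card_inter_cut S hS (hw1 S heq)]
      have : r * a ≤ #(cut f g S) * a := Nat.mul_le_mul_right _ (h.le_card_cut S hS)
      nlinarith
    -- Slack cut: with |∂S| = r + 2t and total k + 2m, strictness means m ≤ tA - 1. Bounding |N ∩
    -- ∂S| by r + 2t ≤ 2a + 1 + 2t reduces the claim to (a - 1)(t - 1) ≥ 0.
    · have hNle : #(N ∩ cut f g S) ≤ #(cut f g S) := card_le_card inter_subset_right
      rw [hm, ht] at hlt ⊢
      rw [ht] at hNle
      have h1 : m < t * A := by nlinarith
      have ht1 : 1 ≤ t := by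
        rcases Nat.eq_zero_or_pos t with rfl | h
        · simp at h1
        · exact h
      obtain ⟨t, rfl⟩ := Nat.exists_eq_add_of_le ht1
      obtain ⟨a, rfl⟩ := Nat.exists_eq_add_of_le ha
      nlinarith [Nat.zero_le (t * a)]
  · have hwU : ∀ e ∈ uncovered M k, w e = A / D := by
      intro e he
      have he' : ∀ i < k, e ∉ M i := by simpa [uncovered] using he
      have : n e = 0 := sum_eq_zero fun i hi => if_neg (he' i (mem_range.1 hi))
      simp [w, this]
    have h1 : ∑ e, (if e ∈ uncovered M k then 1 else 0) * w e = #(uncovered M k) * (A / D) := by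
      simp only [ite_mul, one_mul, zero_mul, sum_ite_mem, univ_inter]
      rw [sum_congr rfl hwU, sum_const, nsmul_eq_mul]
    have h2 : ∑ e ∈ N, (if e ∈ uncovered M k then (1 : ℝ) else 0) = #(uncovered M k ∩ N) := by
      rw [sum_ite_mem, inter_comm]
      simp
    have h3 : (#(uncovered M k ∩ N) : ℝ) + #(uncovered M k \ N) = #(uncovered M k) := by
      exact_mod_cast card_inter_add_card_sdiff _ _
    rw [h1, h2] at hc
    have hfac : (((r : ℝ) - 1) * (a * k + b) - k) / (r * (a * k + b) - k) = 1 - A / D := by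
      have : ((a : ℝ) * k + b) = A := by rw [hA]; push_cast; rfl
      rw [this, ← hD, eq_sub_iff_add_eq, ← add_div, div_eq_one_iff_eq hD0.ne', hD]
      ring
    rw [hfac]
    linarith

open Classical in
theorem IsRGraph.exists_isSparseFamily [Fintype V] (h : IsRGraph f g r) (hr : 2 ≤ r) (ha : 1 ≤ a)
    (hra : r ≤ 2 * a + 1) (hb : 1 ≤ b) (k : ℕ) :
    ∃ M : ℕ → Finset E, IsSparseFamily f g r a b k M ∧
      (#(uncovered M k) : ℝ) ≤ Fintype.card E *
        ∏ i ∈ range k, (((r - 1) * (a * i + b) - i) / (r * (a * i + b) - i) : ℝ) := by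
  induction k with
  | zero =>
    refine ⟨fun _ => ∅, ⟨by simp, fun S hS => ?_⟩, ?_⟩
    · simpa using Nat.mul_le_mul_right b (h.le_card_cut S hS)
    · simp [uncovered]
  | succ k ih =>
    obtain ⟨M, hM, hU⟩ := ih
    obtain ⟨N, hN, hS, hN'⟩ := hM.exists_next h hr ha hra hb
    have hlt : ∀ i < k, Function.update M k N i = M i :=
      fun i hi => Function.update_of_ne hi.ne _ _
    refine ⟨Function.update M k N, ⟨fun i hi => ?_, fun S hSo => ?_⟩, ?_⟩
    · rcases Nat.lt_succ_iff_lt_or_eq.1 hi with hi | rfl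
      · rw [hlt i hi]
        exact hM.perfect i hi
      · simpa using hN
    · rw [sum_range_succ, Function.update_self,
        sum_congr rfl fun i hi => by rw [hlt i (mem_range.1 hi)]]
      exact hS S hSo
    · have hUk : uncovered (Function.update M k N) (k + 1) = uncovered M k \ N := by
        ext e
        simp only [uncovered, mem_filter, mem_univ, true_and, mem_sdiff, Nat.forall_lt_succ_right,
          Function.update_self, and_congr_left_iff]
        intro _
        exact forall₂_congr fun i hi => by rw [hlt i hi]
      rw [hUk, prod_range_succ, ← mul_assoc]
      refine hN'.trans (mul_le_mul_of_nonneg_right hU ?_)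
      have h1 : (1 : ℝ) ≤ a := by exact_mod_cast ha
      have h2 : (1 : ℝ) ≤ b := by exact_mod_cast hb
      have h3 : (2 : ℝ) ≤ r := by exact_mod_cast hr
      have h4 : (0 : ℝ) ≤ k := k.cast_nonneg
      have h5 : (k : ℝ) ≤ a * k + b := by nlinarith
      exact div_nonneg (by nlinarith) (by nlinarith)

end Family

end EdgeCut

/-! ### Transfer to `Graph` through end maps. -/

namespace Graph

variable {α β : Type*} {G : Graph α β} {r : ℕ}

lemma incidenceSet_eq_union (v : α) :
    G.incidenceSet v = G.edgeBoundary {v} ∪ G.loopSet v := by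
  ext e
  constructor
  · rintro ⟨y, hy⟩
    by_cases h : y = v
    · subst h
      exact .inr hy
    · exact .inl ⟨v, y, hy, rfl, h⟩
  · rintro (⟨x, y, h, rfl, -⟩ | h)
    · exact h.inc_left
    · exact h.inc

lemma disjoint_edgeBoundary_loopSet (v : α) : Disjoint (G.edgeBoundary {v}) (G.loopSet v) := by
  rw [Set.disjoint_left]
  rintro e ⟨x, y, h, rfl, hy⟩ hl
  exact hy (IsLoopAt.eq_of_inc hl h.inc_right).symm

lemma mem_edgeBoundary_iff {e : β} {x y : α} (h : G.IsLink e x y) (S : Set α) :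
    e ∈ G.edgeBoundary S ↔ ¬(x ∈ S ↔ y ∈ S) := by
  constructor
  · rintro ⟨x', y', h', hx, hy⟩
    rcases h.eq_and_eq_or_eq_and_eq h' with ⟨rfl, rfl⟩ | ⟨rfl, rfl⟩ <;> tauto
  · intro hn
    by_cases hx : x ∈ S
    · exact ⟨x, y, h, hx, by tauto⟩
    · exact ⟨y, x, h.symm, by tauto, hx⟩

lemma edgeBoundary_subset_edgeSet (S : Set α) : G.edgeBoundary S ⊆ G.edgeSet :=
  fun _ ⟨_, _, h, _⟩ => h.edge_mem

lemma IsRGraph.vertexDegree_eq_add (hG : G.IsRGraph r) (v : α) :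
    G.vertexDegree v = (G.edgeBoundary {v}).ncard + 2 * (G.loopSet v).ncard := by
  rw [vertexDegree, incidenceSet_eq_union, Set.ncard_union_eq (disjoint_edgeBoundary_loopSet v)
    (hG.finite_edgeSet.subset (edgeBoundary_subset_edgeSet _))
    (hG.finite_edgeSet.subset fun e h => IsLoopAt.edge_mem h)]
  ring

lemma IsRGraph.le_ncard_edgeBoundary_singleton (hG : G.IsRGraph r) {v : α} (hv : v ∈ G.vertexSet) :
    r ≤ (G.edgeBoundary {v}).ncard :=
  hG.le_ncard_edgeBoundary {v} (by simpa using hv) (by simp)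

/-- The odd-set condition at a single vertex already uses up the degree r, and a loop would add 2.
-/
lemma IsRGraph.not_isLoopAt (hG : G.IsRGraph r) (e : β) (v : α) : ¬G.IsLoopAt e v := by
  intro h
  have h1 := hG.le_ncard_edgeBoundary_singleton h.vertex_mem
  rw [← hG.regular v h.vertex_mem, hG.vertexDegree_eq_add v] at h1
  have h2 : 0 < (G.loopSet v).ncard :=
    (Set.ncard_pos (hG.finite_edgeSet.subset fun e h => IsLoopAt.edge_mem h)).2 ⟨e, h⟩
  omega

lemma IsRGraph.ncard_edgeBoundary_singleton (hG : G.IsRGraph r) {v : α} (hv : v ∈ G.vertexSet) :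
    (G.edgeBoundary {v}).ncard = r := by
  have h1 := hG.le_ncard_edgeBoundary_singleton hv
  have h2 := hG.vertexDegree_eq_add v
  rw [hG.regular v hv] at h2
  omega

section EndMaps

variable [Fintype G.edgeSet] {f g : G.edgeSet → G.vertexSet}

lemma edgeBoundary_image (hfg : ∀ e, G.IsLink e.1 (f e).1 (g e).1) (S : Finset G.vertexSet) :
    G.edgeBoundary (Subtype.val '' (S : Set G.vertexSet)) =
      Subtype.val '' (EdgeCut.cut f g S : Set G.edgeSet) := by
  have key : ∀ e : G.edgeSet, e.1 ∈ G.edgeBoundary (Subtype.val '' (S : Set G.vertexSet)) ↔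
      e ∈ EdgeCut.cut f g S := by
    intro e
    rw [mem_edgeBoundary_iff (hfg e), EdgeCut.mem_cut]
    simp
  ext e
  constructor
  · intro h
    exact ⟨⟨e, edgeBoundary_subset_edgeSet _ h⟩, (key _).1 h, rfl⟩
  · rintro ⟨e, h, rfl⟩
    exact (key e).2 h

lemma ncard_edgeBoundary_image (hfg : ∀ e, G.IsLink e.1 (f e).1 (g e).1)
    (S : Finset G.vertexSet) : (G.edgeBoundary (Subtype.val '' (S : Set G.vertexSet))).ncard =
      (EdgeCut.cut f g S).card := by
  rw [edgeBoundary_image hfg, Set.ncard_image_of_injective _ Subtype.val_injective,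
    Set.ncard_coe_finset]

open Classical in
lemma ncard_inter_edgeBoundary_image (hfg : ∀ e, G.IsLink e.1 (f e).1 (g e).1)
    (M : Finset G.edgeSet) (S : Finset G.vertexSet) :
    (Subtype.val '' (M : Set G.edgeSet) ∩
      G.edgeBoundary (Subtype.val '' (S : Set G.vertexSet))).ncard =
      (M ∩ EdgeCut.cut f g S).card := by
  rw [edgeBoundary_image hfg, ← Set.image_inter Subtype.val_injective,
    Set.ncard_image_of_injective _ Subtype.val_injective, ← Finset.coe_inter, Set.ncard_coe_finset]

lemma IsRGraph.edgeCut (hG : G.IsRGraph r) (hfg : ∀ e, G.IsLink e.1 (f e).1 (g e).1) :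
    EdgeCut.IsRGraph f g r := by
  refine ⟨fun e he => ?_, fun v => ?_, fun S hS => ?_⟩
  · have := hfg e
    rw [he] at this
    exact hG.not_isLoopAt _ _ this
  · rw [← ncard_edgeBoundary_image hfg, Finset.coe_singleton, Set.image_singleton]
    exact hG.ncard_edgeBoundary_singleton v.2
  · rw [← ncard_edgeBoundary_image hfg]
    refine hG.le_ncard_edgeBoundary _ (by simp) ?_
    rwa [Set.ncard_image_of_injective _ Subtype.val_injective, Set.ncard_coe_finset]

lemma IsRGraph.isOneFactor_image (hG : G.IsRGraph r) (hfg : ∀ e, G.IsLink e.1 (f e).1 (g e).1)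
    {M : Finset G.edgeSet} (hM : EdgeCut.IsPerfect f g M) :
    G.IsOneFactor (Subtype.val '' (M : Set G.edgeSet)) := by
  refine ⟨by simp, fun e _ v => hG.not_isLoopAt e v, fun v hv => ?_⟩
  have hinc : ∀ e : G.edgeSet, G.Inc e.1 v ↔ e ∈ EdgeCut.cut f g {⟨v, hv⟩} := by
    intro e
    have hne := (hG.edgeCut hfg).ne e
    rw [EdgeCut.mem_cut]
    simp only [Finset.mem_singleton]
    constructor
    · intro h
      rcases h.eq_or_eq_of_isLink (hfg e) with rfl | rfl
      · simpa using fun h => hne h.symm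
      · simpa using hne
    · intro h
      by_cases h1 : f e = ⟨v, hv⟩
      · have := (hfg e).inc_left
        rwa [h1] at this
      · have h2 : g e = ⟨v, hv⟩ := by tauto
        have := (hfg e).inc_right
        rwa [h2] at this
  obtain ⟨e, ⟨he, hev⟩, huniq⟩ := hM.existsUnique ⟨v, hv⟩
  refine ⟨e.1, ⟨⟨e, he, rfl⟩, (hinc e).2 hev⟩, ?_⟩
  rintro _ ⟨⟨e', he', rfl⟩, h⟩
  rw [huniq e' ⟨he', (hinc e').1 h⟩]

end EndMaps

lemma exists_endMaps (G : Graph α β) :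
    ∃ f g : G.edgeSet → G.vertexSet, ∀ e, G.IsLink e.1 (f e).1 (g e).1 := by
  have : ∀ e : G.edgeSet, ∃ x y, G.IsLink e.1 x y := fun e => exists_isLink_of_mem_edgeSet e.2
  choose x y h using this
  exact ⟨fun e => ⟨x e, (h e).left_mem⟩, fun e => ⟨y e, (h e).right_mem⟩, h⟩

lemma IsRGraph.exists_finset_image (hG : G.IsRGraph r) {S : Set α} (hS : S ⊆ G.vertexSet) :
    ∃ T : Finset G.vertexSet, Subtype.val '' (T : Set G.vertexSet) = S ∧ T.card = S.ncard := by
  have := hG.finite_vertexSet.to_subtype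
  have hfin : (Subtype.val ⁻¹' S : Set G.vertexSet).Finite := Set.toFinite _
  have h : Subtype.val '' (hfin.toFinset : Set G.vertexSet) = S := by
    rw [Set.Finite.coe_toFinset, Subtype.image_preimage_coe, Set.inter_eq_right]
    exact hS
  refine ⟨hfin.toFinset, h, ?_⟩
  rw [← congrArg Set.ncard h, Set.ncard_image_of_injective _ Subtype.val_injective,
    Set.ncard_coe_finset]

lemma IsRGraph.even_ncard_edgeBoundary_iff (hG : G.IsRGraph r) {S : Set α}
    (hS : S ⊆ G.vertexSet) : Even (G.edgeBoundary S).ncard ↔ Even (r * S.ncard) := by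
  have := hG.finite_edgeSet.fintype
  obtain ⟨f, g, hfg⟩ := G.exists_endMaps
  obtain ⟨T, rfl, hT⟩ := hG.exists_finset_image hS
  rw [ncard_edgeBoundary_image hfg, (hG.edgeCut hfg).even_card_cut_iff, hT]

theorem IsRGraph.exists_oneFactors (hG : G.IsRGraph r) (hV : G.vertexSet.Nonempty) {a b : ℕ}
    (hr : 2 ≤ r) (ha : 1 ≤ a) (hra : r ≤ 2 * a + 1) (hb : 1 ≤ b) (k : ℕ) :
    ∃ M : Fin k → Set β, (∀ i, G.IsOneFactor (M i)) ∧
      ((⋃ i, M i).ncard : ℝ) / (G.edgeSet.ncard : ℝ) ≥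
        1 - ∏ i ∈ Finset.range k,
          (((r - 1) * (a * i + b) - i) / (r * (a * i + b) - i) : ℝ) ∧
      ∀ S ⊆ G.vertexSet, Odd S.ncard →
        k ≤ ∑ i, (M i ∩ G.edgeBoundary S).ncard ∧
        ∑ i, (M i ∩ G.edgeBoundary S).ncard + r * (a * k + b) ≤
          (G.edgeBoundary S).ncard * (a * k + b) + k := by
  classical
  have := hG.finite_edgeSet.fintype
  have := hG.finite_vertexSet.fintype
  obtain ⟨f, g, hfg⟩ := G.exists_endMaps
  have hE := hG.edgeCut hfg
  obtain ⟨M, hM, hU⟩ := hE.exists_isSparseFamily hr ha hra hb k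
  refine ⟨fun i => Subtype.val '' (M i : Set G.edgeSet),
    fun i => hG.isOneFactor_image hfg (hM.perfect i i.2), ?_, fun S hS hodd => ?_⟩
  · have hunion : (⋃ i : Fin k, Subtype.val '' (M i : Set G.edgeSet)).ncard =
        (EdgeCut.uncovered M k)ᶜ.card := by
      rw [← Set.image_iUnion, Set.ncard_image_of_injective _ Subtype.val_injective,
        ← Set.ncard_coe_finset]
      congr 1
      ext e
      simp [EdgeCut.uncovered, Fin.exists_iff]
    have hcard : G.edgeSet.ncard = Fintype.card G.edgeSet := by
      rw [← Nat.card_coe_set_eq, Nat.card_eq_fintype_card]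
    have hpos : (0 : ℝ) < Fintype.card G.edgeSet := by
      obtain ⟨v, hv⟩ := hV
      have h1 := hE.card_star ⟨v, hv⟩
      have h2 := Finset.card_le_univ (EdgeCut.cut f g {⟨v, hv⟩})
      have : 0 < Fintype.card G.edgeSet := by omega
      exact_mod_cast this
    have hadd : ((EdgeCut.uncovered M k)ᶜ.card : ℝ) + (EdgeCut.uncovered M k).card =
        Fintype.card G.edgeSet := by
      exact_mod_cast Finset.card_compl_add_card _
    rw [hunion, hcard, ge_iff_le, le_div_iff₀ hpos]
    linarith
  · obtain ⟨T, rfl, hT⟩ := hG.exists_finset_image hS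
    rw [← hT] at hodd
    simp only [ncard_inter_edgeBoundary_image hfg, ncard_edgeBoundary_image hfg]
    rw [Fin.sum_univ_eq_sum_range fun i => (M i ∩ EdgeCut.cut f g T).card]
    have h1 := hM.sum_le T hodd
    obtain ⟨m, hm⟩ := hM.exists_eq_add hE hodd
    refine ⟨?_, by convert h1⟩
    convert Nat.le.intro hm.symm

end Graph

/-! ### Choice of parameters and the main theorem. -/

lemma Finset.prod_Icc_one_eq_prod_range {R : Type*} [CommMonoid R] (F : ℕ → R) (k : ℕ) :
    ∏ i ∈ Finset.Icc 1 k, F i = ∏ i ∈ Finset.range k, F (i + 1) := by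
  rw [Finset.range_eq_Ico, Finset.prod_Ico_add', zero_add]
  rfl

theorem mainTheorem1 {α β : Type*} (G : Graph α β) (r k : ℕ)
    (hG : G.IsRGraph r) (hV : G.vertexSet.Nonempty) (hk : 1 ≤ k) :
    (Even r → 4 ≤ r →
      ∃ M : Fin k → Set β, (∀ i, G.IsOneFactor (M i)) ∧
        ((⋃ i, M i).ncard : ℝ) / (G.edgeSet.ncard : ℝ) ≥
          1 - ∏ i ∈ Finset.Icc 1 k,
            (((r : ℝ) ^ 2 - 3 * r + 1) * (i : ℝ) - ((r : ℝ) ^ 2 - 5 * r + 3)) /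
              (((r : ℝ) ^ 2 - 2 * r - 1) * (i : ℝ) - ((r : ℝ) ^ 2 - 4 * r - 1)) ∧
        ∀ C : Set β, G.IsCutOfSize (r + 1) C →
          ∑ i, (M i ∩ C).ncard ≤ (r - 1) * k + 2) ∧
    (Odd r → 3 ≤ r →
      ∃ M : Fin k → Set β, (∀ i, G.IsOneFactor (M i)) ∧
        ((⋃ i, M i).ncard : ℝ) / (G.edgeSet.ncard : ℝ) ≥
          1 - ∏ i ∈ Finset.Icc 1 k,
            (((r : ℝ) ^ 2 - 2 * r - 1) * (i : ℝ) - ((r : ℝ) ^ 2 - 4 * r + 1)) /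
              (((r : ℝ) ^ 2 - r - 2) * (i : ℝ) - ((r : ℝ) ^ 2 - 3 * r - 2)) ∧
        (∀ C : Set β, G.IsCutOfSize r C → ∑ i, (M i ∩ C).ncard = k) ∧
        ∀ D : Set β, G.IsCutOfSize (r + 2) D →
          ∑ i, (M i ∩ D).ncard ≤ r * k + 2) := by
  constructor
  · intro hr hr4
    -- a = r - 2 and b = 2 are read off the stated factors after the shift from i to i + 1.
    obtain ⟨a, rfl⟩ := Nat.exists_eq_add_of_le' (by omega : 2 ≤ r)
    obtain ⟨M, hM, hU, -⟩ := hG.exists_oneFactors hV (a := a) (b := 2) (by omega) (by omega)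
      (by omega) (by omega) k
    refine ⟨M, hM, ?_, fun C hC => ?_⟩
    · convert hU using 2
      rw [Finset.prod_Icc_one_eq_prod_range]
      refine Finset.prod_congr rfl fun i _ => ?_
      push_cast
      congr 1 <;> ring
    · obtain ⟨⟨S, hS, rfl⟩, hcard⟩ := hC
      -- For even r every cut is even, so there are no (r + 1)-cuts.
      have h := hG.even_ncard_edgeBoundary_iff hS
      rw [hcard] at h
      exact absurd (h.2 (hr.mul_right _)) (Nat.not_even_iff_odd.2 hr.add_one)
  · intro hr hr3
    have hodd : ∀ S ⊆ G.vertexSet, Odd (G.edgeBoundary S).ncard → Odd S.ncard := by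
      intro S hS h
      rw [← Nat.not_even_iff_odd, hG.even_ncard_edgeBoundary_iff hS, Nat.not_even_iff_odd] at h
      exact (Nat.odd_mul.1 h).2
    obtain ⟨a, rfl⟩ := hr
    obtain ⟨M, hM, hU, hS⟩ := hG.exists_oneFactors hV (a := a) (b := 1) (by omega) (by omega)
      (by omega) (by omega) k
    refine ⟨M, hM, ?_, fun C hC => ?_, fun D hD => ?_⟩
    · convert hU using 2
      rw [Finset.prod_Icc_one_eq_prod_range]
      refine Finset.prod_congr rfl fun i _ => ?_
      -- The factor 2 clears the denominator of a = (r - 1) / 2.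
      rw [← mul_div_mul_left _ (_ - (i : ℝ)) (two_ne_zero' ℝ)]
      push_cast
      congr 1 <;> ring
    · obtain ⟨⟨S, hSV, rfl⟩, hcard⟩ := hC
      have h := hS S hSV (hodd S hSV (hcard ▸ odd_two_mul_add_one a))
      rw [hcard] at h
      omega
    · obtain ⟨⟨S, hSV, rfl⟩, hcard⟩ := hD
      have h := (hS S hSV (hodd S hSV (hcard ▸ ⟨a + 1, by ring⟩))).2
      rw [hcard] at h
      -- The invariant gives at most 2(ak + 1) + k = (2a + 1)k + 2.
      nlinarith
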